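/- Let $\mathcal H=(V,\mathcal E)$ be a finite hyper-graph, i.e. $V$ is a finite set and $\mathcal E\subseteq 2^V$, with $|V|=n$, $|\mathcal E|=m$ and rank $r$ (the maximum cardinality of a hyper-edge). Assume that $\mathcal H$ is connected: any two vertices are joined by a finite sequence of vertices in which consecutive vertices lie in a common hyper-edge. The simple random walk on $\mathcal H$ started at $X(0)=v$ chooses, at each time $t=0,1,2,\dots$, a hyper-edge $e(t)$ uniformly among the hyper-edges containing $X(t)$, and then $X(t+1)$ uniformly in $e(t)$. (If the only vertex of $\mathcal H$ lies in no hyper-edge, the walk stays there.) Write $T_v^u=\inf\{t\ge 0: X(t)=u\}$ for the number of steps until $u$ is visited, and $\widetilde T_v^u$ for the number of steps until $u$ has heard the walk: $\widetilde T_v^v=0$, and $\widetilde T_v^u=\inf\{t\ge 1: u\in e(t-1)\}$ for $u\ne v$ (with $\inf\emptyset=\infty$). The cover time and the radio cover time of $\mathcal H$ are $$C=\max_{v\in V}\mathbb E\Big[\max_{u\in V}T_v^u\Big],\qquad \widetilde C=\max_{v\in V}\mathbb E\Big[\max_{u\in V}\widetilde T_v^u\Big].$$ Then $$\widetilde C\le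 C=O(m\cdot n\cdot r),$$ that is, there is an absolute constant $K$ such that $\widetilde C\le C\le K\,m\,n\,r$ for every finite connected hyper-graph. -/

import Mathlib

open MeasureTheory ProbabilityTheory
open scoped ENNReal NNReal

namespace HypergraphWalk

/-- `H` is connected: any two vertices are joined by a hyper-path, i.e. a finite sequence of
vertices in which consecutive vertices lie in a common hyper-edge. -/
def IsConnected {V : Type*} (H : Hypergraph V) : Prop :=
  ∀ u ∈ H.vertexSet, ∀ v ∈ H.vertexSet, Relation.ReflTransGen H.Adj u v

/-- The rank of `H`: the maximum cardinality of a hyper-edge (`0` if there is no hyper-edge). -/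
noncomputable def rank {V : Type*} (H : Hypergraph V) : ℕ :=
  sSup (Set.ncard '' H.edgeSet)

open Classical in
/-- The uniform distribution on a non-empty finite set `s`. (If `s` is empty or infinite, the
default value `b` is chosen with probability one.) -/
noncomputable def uniform {β : Type*} (s : Set β) (b : β) : PMF β :=
  if h : s.Finite ∧ s.Nonempty then
    PMF.uniformOfFinset h.1.toFinset (h.1.toFinset_nonempty.mpr h.2)
  else PMF.pure b

/-- The state of the random walk at time `t`: the current vertex `X(t)` and the hyper-edge `e(t)`
containing it along which the walk moves from `X(t)` to `X(t+1)`. -/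
structure State (V : Type*) where
  /-- the current vertex `X(t)` -/
  vertex : V
  /-- the hyper-edge `e(t)` used for the step from `X(t)` to `X(t+1)` -/
  edge : Set V

instance instMeasurableSpaceState (V : Type*) : MeasurableSpace (State V) := ⊤

/-- The state of a walk that is at `v`: the hyper-edge is uniform among the hyper-edges that
contain `v`. (If no hyper-edge contains `v`, the walk uses `{v}` instead, and so stays at `v`.) -/
noncomputable def stateAt {V : Type*} (H : Hypergraph V) (v : V) : PMF (State V) :=
  (uniform {e | e ∈ H.edgeSet ∧ v ∈ e} {v}).map (fun e => State.mk v e)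

/-- One step of the simple random walk: `X(t+1)` is uniform in `e(t)`, and then `e(t+1)` is uniform
among the hyper-edges that contain `X(t+1)`. -/
noncomputable def step {V : Type*} (H : Hypergraph V) (s : State V) : PMF (State V) :=
  (uniform s.edge s.vertex).bind (stateAt H)

/-- The Markov kernel of the step. -/
noncomputable def stepKernel {V : Type*} (H : Hypergraph V) : Kernel (State V) (State V) where
  toFun s := (step H s).toMeasure
  measurable' := measurable_from_top

instance instIsMarkovKernelStepKernel {V : Type*} (H : Hypergraph V) :
    IsMarkovKernel (stepKernel H) :=
  ⟨fun s => PMF.toMeasure.isProbabilityMeasure (step H s)⟩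

/-- The law of the simple random walk `t ↦ (X(t), e(t))` on `H` with `X(0) = v`. -/
noncomputable def walkLaw {V : Type*} (H : Hypergraph V) (v : V) : Measure (ℕ → State V) :=
  Kernel.trajMeasure (X := fun _ => State V) (stateAt H v).toMeasure
    (fun n => (stepKernel H).comap
      (fun h : (i : Finset.Iic n) → State V => h ⟨n, Finset.mem_Iic.mpr le_rfl⟩)
      (measurable_pi_apply _))

/-- The first time at which the walk visits `u` (`⊤` if there is none). -/
noncomputable def hitTime {V : Type*} (u : V) (ω : ℕ → State V) : ℕ∞ :=
  ⨅ (t : ℕ) (_ : (ω t).vertex = u), (t : ℕ∞)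

/-- The number of steps after which `u` has heard the walk for the first time (`⊤` if there is
none): after `t` steps, `u` has heard the walk if it is the starting vertex or lies in one of the
hyper-edges `e(0), …, e(t-1)` used so far. -/
noncomputable def radioHitTime {V : Type*} (u : V) (ω : ℕ → State V) : ℕ∞ :=
  ⨅ (t : ℕ) (_ : (ω 0).vertex = u ∨ ∃ s < t, u ∈ (ω s).edge), (t : ℕ∞)

/-- The cover time `max_v E[max_u T_v^u]`. -/
noncomputable def coverTime {V : Type*} (H : Hypergraph V) : ℝ≥0∞ :=
  ⨆ v ∈ H.vertexSet, ∫⁻ ω, ((⨆ u ∈ H.vertexSet, hitTime u ω : ℕ∞) : ℝ≥0∞) ∂(walkLaw H v)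

/-- The radio cover time: as the cover time, with radio hitting times. -/
noncomputable def radioCoverTime {V : Type*} (H : Hypergraph V) : ℝ≥0∞ :=
  ⨆ v ∈ H.vertexSet, ∫⁻ ω, ((⨆ u ∈ H.vertexSet, radioHitTime u ω : ℕ∞) : ℝ≥0∞) ∂(walkLaw H v)

end HypergraphWalk

/-! The walk is the random walk on the bipartite incidence graph of vertices and hyper-edges, one
step of it being two graph steps. This graph has total degree at most `2 * m * r`. In a reversible
network, Kac's formula bounds the weight of `w` times the mean return time to `w` by the total
weight; looking at the first step of the return, the mean hitting time of `w` from a neighbour along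
a unit conductance is at most the total weight (`mul_hit_le_totalWeight`). By connectedness some
closed-up exploration along incidences sees all `n` vertices in `4 * (n - 1)` graph steps
(`exists_tour`). Visiting its nodes in order costs at most the total weight per node, whence `8 * m
* n * r`. The addition of hitting times is done without stopping times: `potential` bounds the
remaining cost and decreases in mean by at least one per step while targets remain. The comparison
with the radio cover time holds path by path, since `X(t+1)` lies in `e(t)`. -/

namespace FiniteNetwork

/-! ### Return and hitting times in finite reversible networks -/

variable {B : Type*} [Fintype B]

/-- The total conductance at a node. -/
noncomputable def nodeWeight (c : B → B → ℝ≥0∞) (b : B) : ℝ≥0∞ := ∑ x, c b x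

/-- The sum of all conductances, each unordered pair being counted twice. -/
noncomputable def totalWeight (c : B → B → ℝ≥0∞) : ℝ≥0∞ := ∑ b, nodeWeight c b

/-- The mean value of `F` after one step of the network walk from `b`. -/
noncomputable def mean (c : B → B → ℝ≥0∞) (b : B) (F : B → ℝ≥0∞) : ℝ≥0∞ :=
  (∑ x, c b x * F x) / nodeWeight c b

variable {c : B → B → ℝ≥0∞}

lemma mean_mono {F G : B → ℝ≥0∞} (b : B) (h : ∀ x, c b x ≠ 0 → F x ≤ G x) :
    mean c b F ≤ mean c b G := by
  refine ENNReal.div_le_div_right (Finset.sum_le_sum fun x _ => ?_) _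
  by_cases hx : c b x = 0
  · simp [hx]
  · gcongr; exact h x hx

lemma mean_add (b : B) (F G : B → ℝ≥0∞) :
    mean c b (fun x => F x + G x) = mean c b F + mean c b G := by
  simp only [mean, mul_add, Finset.sum_add_distrib, ENNReal.add_div]

/-- Only an inequality: at a node of weight zero the quotient `0 / 0` is `0`. -/
lemma mean_const_le (b : B) (a : ℝ≥0∞) : mean c b (fun _ => a) ≤ a := by
  rw [mean, ← Finset.sum_mul, ← nodeWeight, mul_comm, mul_div_assoc]
  exact mul_le_of_le_one_right' ENNReal.div_self_le_one

lemma nodeWeight_ne_top (hc : ∀ a b, c a b ≠ ∞) (b : B) : nodeWeight c b ≠ ∞ :=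
  ENNReal.sum_ne_top.2 fun x _ => hc b x

lemma nodeWeight_mul_mean (hc : ∀ a b, c a b ≠ ∞) (b : B) (F : B → ℝ≥0∞) :
    nodeWeight c b * mean c b F = ∑ x, c b x * F x := by
  by_cases h0 : nodeWeight c b = 0
  · have : ∀ x, c b x = 0 := by simpa [nodeWeight] using h0
    simp [h0, this]
  · exact ENNReal.mul_div_cancel h0 (nodeWeight_ne_top hc b)

variable [DecidableEq B]

/-- The expected value of `min (n, T)`, where `T` is the first positive time at which the network
walk is at `w`. -/
noncomputable def truncHit (c : B → B → ℝ≥0∞) (w : B) : ℕ → B → ℝ≥0∞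
  | 0, _ => 0
  | n + 1, b => 1 + mean c b (fun x => if x = w then 0 else truncHit c w n x)

/-- The expected first positive time at which the network walk is at `w`. -/
noncomputable def hit (c : B → B → ℝ≥0∞) (w b : B) : ℝ≥0∞ := ⨆ n, truncHit c w n b

lemma truncHit_le_succ (w : B) (n : ℕ) : ∀ b, truncHit c w n b ≤ truncHit c w (n + 1) b := by
  induction n with
  | zero => intro b; simp [truncHit]
  | succ n ih =>
    intro b
    rw [truncHit, truncHit]
    gcongr
    refine mean_mono b fun x _ => ?_
    split_ifs
    · rfl
    · exact ih x

lemma monotone_truncHit (w b : B) : Monotone fun n => truncHit c w n b :=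
  monotone_nat_of_le_succ fun n => truncHit_le_succ w n b

lemma truncHit_le (w : B) (n : ℕ) : ∀ b, truncHit c w n b ≤ n := by
  induction n with
  | zero => intro b; simp [truncHit]
  | succ n ih =>
    intro b
    rw [truncHit, Nat.cast_succ, add_comm]
    gcongr
    refine (mean_mono b fun x _ => ?_).trans (mean_const_le b _)
    split_ifs
    · simp
    · exact ih x

/-- Kac's formula, as an inequality. -/
lemma nodeWeight_mul_truncHit_le (hc : ∀ a b, c a b ≠ ∞) (hs : ∀ a b, c a b = c b a)
    (w : B) (n : ℕ) : nodeWeight c w * truncHit c w n w ≤ totalWeight c := by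
  set R := ∑ x, nodeWeight c x * (if x = w then 0 else truncHit c w n x) with hR
  -- Truncation makes `R` finite, so that it can be cancelled at the end.
  have hfin : R ≠ ∞ := by
    refine ENNReal.sum_ne_top.2 fun x _ => ENNReal.mul_ne_top (nodeWeight_ne_top hc x) ?_
    split_ifs
    · simp
    · exact ne_top_of_le_ne_top (ENNReal.natCast_ne_top n) (truncHit_le w n x)
  have h1 : ∑ b, nodeWeight c b * truncHit c w n b = R + nodeWeight c w * truncHit c w n w := by
    have : ∀ b, nodeWeight c b * truncHit c w n b =
        nodeWeight c b * (if b = w then 0 else truncHit c w n b) +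
          if b = w then nodeWeight c w * truncHit c w n w else 0 := by
      intro b
      split_ifs with h
      · simp [h]
      · simp
    rw [Finset.sum_congr rfl fun b _ => this b, Finset.sum_add_distrib]
    simp [hR]
  -- Symmetry of `c` makes `nodeWeight` a stationary measure.
  have h2 : ∑ b, nodeWeight c b * truncHit c w (n + 1) b = R + totalWeight c := by
    simp only [truncHit, mul_add, mul_one, nodeWeight_mul_mean hc, Finset.sum_add_distrib]
    rw [add_comm, Finset.sum_comm, totalWeight, hR]
    congr 1
    refine Finset.sum_congr rfl fun x _ => ?_
    rw [← Finset.sum_mul, nodeWeight]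
    simp only [hs x]
  have h3 : ∑ b, nodeWeight c b * truncHit c w n b ≤ ∑ b, nodeWeight c b * truncHit c w (n + 1) b :=
    Finset.sum_le_sum fun b _ => mul_le_mul_right (truncHit_le_succ w n b) _
  rw [h1, h2] at h3
  exact (ENNReal.add_le_add_iff_left hfin).1 h3

/-- The expected hitting time of a node from a neighbour. -/
lemma mul_hit_le_totalWeight (hc : ∀ a b, c a b ≠ ∞) (hs : ∀ a b, c a b = c b a) (w x : B) :
    c x w * hit c w x ≤ totalWeight c := by
  rw [hit, ENNReal.mul_iSup]
  refine iSup_le fun n => ?_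
  by_cases hx : x = w
  · subst hx
    refine le_trans ?_ (nodeWeight_mul_truncHit_le hc hs x n)
    gcongr
    exact Finset.single_le_sum (f := fun y => c x y) (fun _ _ => zero_le) (Finset.mem_univ x)
  -- The return to `w` may begin with the step from `w` to `x`; only this term of the first-step
  -- expansion is kept.
  · refine le_trans ?_ (nodeWeight_mul_truncHit_le hc hs w (n + 1))
    rw [truncHit, mul_add, nodeWeight_mul_mean hc]
    refine le_trans ?_ le_add_self
    refine le_trans ?_ (Finset.single_le_sum
      (f := fun y => c w y * if y = w then 0 else truncHit c w n y)
      (fun _ _ => zero_le) (Finset.mem_univ x))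
    simp [hx, hs x w]

/-- First-step recursion, passed to the limit by monotone convergence. -/
lemma one_add_mean_hit_le (w b : B) :
    1 + mean c b (fun x => if x = w then 0 else hit c w x) ≤ hit c w b := by
  have : mean c b (fun x => if x = w then 0 else hit c w x) =
      ⨆ n, mean c b (fun x => if x = w then 0 else truncHit c w n x) := by
    simp only [mean, ← ENNReal.iSup_div]
    congr 1
    rw [← ENNReal.finsetSum_iSup_of_monotone]
    · refine Finset.sum_congr rfl fun x _ => ?_
      rw [← ENNReal.mul_iSup]
      split_ifs
      · simp
      · rfl
    · intro x i j hij
      dsimp only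
      split_ifs
      · rfl
      · gcongr; exact monotone_truncHit w x hij
  rw [this, ENNReal.add_iSup]
  exact iSup_le fun n => le_iSup (fun n => truncHit c w n b) (n + 1)

/-! ### Visiting targets in order -/

/-- The targets that remain after a visit to `x`, when they have to be visited in order. -/
def advance : List B → B → List B
  | [], _ => []
  | w :: l, x => if x = w then l else w :: l

/-- An upper bound for the expected time that the network walk from `b` needs to visit the nodes of
a list in order. -/
noncomputable def potential (c : B → B → ℝ≥0∞) : List B → B → ℝ≥0∞
  | [], _ => 0
  | w :: l, b => hit c w b + totalWeight c * l.length

/-- The next target is a neighbour of `b` with unit conductance, so reaching it costs at most one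
more `totalWeight c`. -/
lemma potential_cons_le (hc : ∀ a b, c a b ≠ ∞) (hs : ∀ a b, c a b = c b a) {b : B} {l : List B}
    (hl : (b :: l).IsChain fun x y => c x y = 1) :
    potential c l b ≤ totalWeight c * l.length := by
  cases l with
  | nil => simp [potential]
  | cons w l =>
    have h := mul_hit_le_totalWeight hc hs w b
    rw [(List.isChain_cons_cons.1 hl).1, one_mul] at h
    rw [potential, List.length_cons, Nat.cast_succ, mul_add, mul_one, add_comm]
    gcongr

omit [Fintype B] in
lemma isChain_advance {r : B → B → Prop} {l : List B} (hl : l.IsChain r) (x : B) :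
    (advance l x).IsChain r := by
  cases l with
  | nil => exact hl
  | cons w l =>
    rw [advance]
    split_ifs
    · exact hl.tail
    · exact hl

omit [Fintype B] in
lemma mem_advance_or_eq {l : List B} {a : B} (h : a ∈ l) (x : B) :
    a ∈ advance l x ∨ x = a := by
  cases l with
  | nil => simp at h
  | cons w l =>
    rw [advance]
    rcases List.mem_cons.1 h with rfl | h'
    · split_ifs with hx
      · exact Or.inr hx
      · exact Or.inl h
    · split_ifs with hx
      · exact Or.inl h'
      · exact Or.inl h

/-- Supermartingale property with drift one: short of the target this is the recursion for `hit`; on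
reaching it, the potential of the shorter list is absorbed by the term `totalWeight c * l.length`.
-/
lemma mean_potential_advance_le (hc : ∀ a b, c a b ≠ ∞) (hs : ∀ a b, c a b = c b a) {l : List B}
    (hl : l.IsChain fun x y => c x y = 1) (b : B) :
    (if l = [] then 0 else 1) + mean c b (fun x => potential c (advance l x) x) ≤
      potential c l b := by
  cases l with
  | nil => simpa [potential, advance] using mean_const_le b 0
  | cons w l =>
    simp only [reduceCtorEq, if_false]
    calc 1 + mean c b (fun x => potential c (advance (w :: l) x) x)
        ≤ 1 + mean c b (fun x => (if x = w then 0 else hit c w x) + totalWeight c * l.length) := by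
          gcongr
          refine mean_mono b fun x _ => ?_
          rw [advance]
          split_ifs with h
          · subst h
            simpa using potential_cons_le hc hs hl
          · rfl
      _ ≤ hit c w b + totalWeight c * l.length := by
          rw [mean_add, ← add_assoc]
          exact add_le_add (one_add_mean_hit_le w b) (mean_const_le b _)

end FiniteNetwork

/-! ### Expectations under probability mass functions -/

namespace PMF

variable {α β : Type*}

lemma tsum_bind_mul (p : PMF α) (f : α → PMF β) (G : β → ℝ≥0∞) :
    ∑' b, p.bind f b * G b = ∑' a, p a * ∑' b, f a b * G b := by
  simp only [PMF.bind_apply, ← ENNReal.tsum_mul_right, ← ENNReal.tsum_mul_left]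
  rw [ENNReal.tsum_comm]
  simp only [mul_assoc]

lemma tsum_map_mul (p : PMF α) (f : α → β) (G : β → ℝ≥0∞) :
    ∑' b, p.map f b * G b = ∑' a, p a * G (f a) := by
  classical
  rw [PMF.map, tsum_bind_mul]
  congr 1 with a
  congr 1
  rw [tsum_eq_single (f a)]
  · simp
  · intro b hb
    simp [hb]

lemma lintegral_toMeasure [Countable α] [MeasurableSpace α] [MeasurableSingletonClass α]
    (p : PMF α) (G : α → ℝ≥0∞) : ∫⁻ a, G a ∂p.toMeasure = ∑' a, p a * G a := by
  rw [lintegral_countable']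
  congr 1 with a
  rw [PMF.toMeasure_apply_singleton _ _ (measurableSet_singleton a), mul_comm]

end PMF

/-! ### The walk as a walk on the incidence network -/

namespace HypergraphWalk

open FiniteNetwork Classical

variable {V : Type*} [Fintype V] (H : Hypergraph V)

lemma support_uniform {β : Type*} {s : Set β} (hf : s.Finite) (hs : s.Nonempty) (b : β) :
    (uniform s b).support = s := by
  rw [uniform, dif_pos ⟨hf, hs⟩, PMF.support_uniformOfFinset]
  simp

lemma tsum_uniform_mul {β : Type*} [Fintype β] {s : Set β} (hs : s.Nonempty) (b : β)
    (F : β → ℝ≥0∞) : ∑' x, uniform s b x * F x =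
      (∑ x, (if x ∈ s then 1 else 0) * F x) / ∑ x, (if x ∈ s then 1 else 0) := by
  rw [uniform, dif_pos ⟨s.toFinite, hs⟩, tsum_fintype, ENNReal.div_eq_inv_mul, Finset.mul_sum]
  refine Finset.sum_congr rfl fun x _ => ?_
  rw [PMF.uniformOfFinset_apply, ← mul_assoc]
  congr 1
  have : (∑ x, (if x ∈ s then (1 : ℝ≥0∞) else 0)) = (s.toFinite.toFinset.card : ℝ≥0∞) := by
    rw [Finset.sum_boole]
    congr 2
    ext; simp
  simp [this]

/-- The incidence network of a hyper-graph: vertices and hyper-edges are the nodes, and there is a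
unit conductance for each incidence. -/
noncomputable def incidence : V ⊕ Set V → V ⊕ Set V → ℝ≥0∞
  | .inl v, .inr e => if e ∈ H.edgeSet ∧ v ∈ e then 1 else 0
  | .inr e, .inl v => if e ∈ H.edgeSet ∧ v ∈ e then 1 else 0
  | _, _ => 0

omit [Fintype V] in
lemma incidence_ne_top (a b : V ⊕ Set V) : incidence H a b ≠ ∞ := by
  rcases a with a | a <;> rcases b with b | b <;> simp [incidence, ite_eq_iff]

omit [Fintype V] in
lemma incidence_comm (a b : V ⊕ Set V) : incidence H a b = incidence H b a := by
  rcases a with a | a <;> rcases b with b | b <;> rfl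

/-- Each incidence counts once from its vertex and once from its hyper-edge; summing over
hyper-edges gives at most `m * r` per side. -/
lemma totalWeight_incidence_le :
    totalWeight (incidence H) ≤ 2 * (H.edgeSet.ncard * rank H : ℝ≥0∞) := by
  have h : ∑ e : Set V, nodeWeight (incidence H) (.inr e) ≤ H.edgeSet.ncard * rank H := by
    calc ∑ e : Set V, nodeWeight (incidence H) (.inr e)
        ≤ ∑ e : Set V, if e ∈ H.edgeSet then (rank H : ℝ≥0∞) else 0 := by
          refine Finset.sum_le_sum fun e _ => ?_
          rw [nodeWeight, Fintype.sum_sum_type]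
          split_ifs with he
          · have hle : e.ncard ≤ rank H :=
              le_csSup (Set.toFinite _).bddAbove (Set.mem_image_of_mem _ he)
            simp only [incidence, he, true_and, Finset.sum_boole, Finset.sum_const_zero, add_zero]
            refine Nat.cast_le.2 (le_trans (le_of_eq ?_) hle)
            rw [Set.ncard_eq_toFinset_card']
            congr 1
            ext; simp
          · simp [incidence, he]
      _ = H.edgeSet.ncard * rank H := by
          rw [← Finset.sum_filter, Finset.sum_const, nsmul_eq_mul]
          congr 2
          rw [Set.ncard_eq_toFinset_card']
          congr 1
          ext; simp
  have h' : ∑ v : V, nodeWeight (incidence H) (.inl v) =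
      ∑ e : Set V, nodeWeight (incidence H) (.inr e) := by
    simp only [nodeWeight, Fintype.sum_sum_type, incidence, Finset.sum_const_zero, zero_add,
      add_zero]
    exact Finset.sum_comm
  rw [totalWeight, Fintype.sum_sum_type, h', two_mul]
  exact add_le_add h h

lemma tsum_stateAt_mul {v : V} (hv : ∃ e ∈ H.edgeSet, v ∈ e) (G : State V → ℝ≥0∞)
    (F : V ⊕ Set V → ℝ≥0∞) (hF : ∀ e, F (.inr e) = G ⟨v, e⟩) :
    ∑' s, stateAt H v s * G s = mean (incidence H) (.inl v) F := by
  rw [stateAt, PMF.tsum_map_mul,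
    tsum_uniform_mul (s := {e | e ∈ H.edgeSet ∧ v ∈ e}) hv, mean, nodeWeight]
  simp only [Fintype.sum_sum_type, incidence, hF, zero_mul, Finset.sum_const_zero, zero_add]
  congr!

lemma tsum_uniform_edge_mul {e : Set V} (he : e ∈ H.edgeSet) (hne : e.Nonempty) (v : V)
    (F : V ⊕ Set V → ℝ≥0∞) :
    ∑' x, uniform e v x * F (.inl x) = mean (incidence H) (.inr e) F := by
  rw [tsum_uniform_mul hne, mean, nodeWeight]
  simp [Fintype.sum_sum_type, incidence, he, -Finset.sum_boole]

/-- The targets that remain after the state `s`, when nodes of the incidence network have to be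
visited in order. -/
noncomputable def advanceState (l : List (V ⊕ Set V)) (s : State V) : List (V ⊕ Set V) :=
  advance (advance l (.inl s.vertex)) (.inr s.edge)

omit [Fintype V] in
lemma isChain_advanceState {r : V ⊕ Set V → V ⊕ Set V → Prop} {l : List (V ⊕ Set V)}
    (hl : l.IsChain r) (s : State V) : (advanceState l s).IsChain r :=
  isChain_advance (isChain_advance hl _) _

/-- Half-step from vertex to hyper-edge. Its unit of time is discarded, so that each step of the
walk is charged once, in the half-step from hyper-edge to vertex. -/
lemma tsum_stateAt_mul_potential_le {v : V} (hv : ∃ e ∈ H.edgeSet, v ∈ e)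
    {l : List (V ⊕ Set V)} (hl : l.IsChain fun x y => incidence H x y = 1) :
    ∑' s, stateAt H v s * potential (incidence H) (advance l (.inr s.edge)) (.inr s.edge) ≤
      potential (incidence H) l (.inl v) := by
  rw [tsum_stateAt_mul H hv _ (fun b => potential (incidence H) (advance l b) b) fun _ => rfl]
  exact le_add_self.trans
    (mean_potential_advance_le (incidence_ne_top H) (incidence_comm H) hl _)

lemma tsum_step_mul_potential_le {s : State V} (he : s.edge ∈ H.edgeSet) (hs : s.vertex ∈ s.edge)
    {l : List (V ⊕ Set V)} (hl : l.IsChain fun x y => incidence H x y = 1) :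
    (if l = [] then 0 else 1) + ∑' s', step H s s' *
        potential (incidence H) (advanceState l s') (.inr s'.edge) ≤
      potential (incidence H) l (.inr s.edge) := by
  refine le_trans ?_
    (mean_potential_advance_le (incidence_ne_top H) (incidence_comm H) hl (.inr s.edge))
  gcongr
  rw [step, PMF.tsum_bind_mul, ← tsum_uniform_edge_mul H he ⟨_, hs⟩ s.vertex]
  refine ENNReal.tsum_le_tsum fun x => ?_
  by_cases hx : uniform s.edge s.vertex x = 0
  · simp [hx]
  · have hxe : x ∈ s.edge := by
      rw [← support_uniform s.edge.toFinite ⟨_, hs⟩ s.vertex]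
      exact hx
    gcongr
    refine le_trans (le_of_eq ?_)
      (tsum_stateAt_mul_potential_le H ⟨_, he, hxe⟩ (isChain_advance hl (.inl x)))
    rw [stateAt, PMF.tsum_map_mul, PMF.tsum_map_mul]
    rfl

end HypergraphWalk

/-! ### The path law: Markov property and almost sure invariants -/

namespace HypergraphWalk

open FiniteNetwork Classical

variable {V : Type*}

instance instMeasurableSingletonClassState : MeasurableSingletonClass (State V) :=
  ⟨fun _ => trivial⟩

instance instFiniteState [Finite V] : Finite (State V) :=
  Finite.of_injective (fun s => (s.vertex, s.edge)) fun s t h => by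
    cases s; cases t; simpa using h

/-- Extend a finite path by repeating its last state. -/
def extend (k : ℕ) (h : (i : Finset.Iic k) → State V) (i : ℕ) : State V :=
  h ⟨min i k, Finset.mem_Iic.2 (min_le_right i k)⟩

lemma extend_frestrictLe (k : ℕ) (ω : ℕ → State V) {i : ℕ} (hi : i ≤ k) :
    extend k (Preorder.frestrictLe (π := fun _ => State V) k ω) i = ω i := by
  simp [extend, hi]

variable [Finite V] (H : Hypergraph V) (v : V)

instance instIsProbabilityMeasureWalkLaw : IsProbabilityMeasure (walkLaw H v) := by
  unfold walkLaw
  infer_instance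

/-- Such a function factors through the finite, discrete space of paths up to time `k`. -/
lemma measurable_of_eqOn_Iic {β : Type*} [MeasurableSpace β] {F : (ℕ → State V) → β} {k : ℕ}
    (hF : ∀ ω ω', (∀ i ≤ k, ω i = ω' i) → F ω = F ω') : Measurable F := by
  have h : F = (fun h => F (extend k h)) ∘ Preorder.frestrictLe (π := fun _ => State V) k := by
    funext ω
    exact hF _ _ fun i hi => (extend_frestrictLe k ω hi).symm
  rw [h]
  exact (measurable_of_finite _).comp (by fun_prop)

lemma lintegral_walkLaw_zero (G : State V → ℝ≥0∞) :
    ∫⁻ ω, G (ω 0) ∂(walkLaw H v) = ∑' s, stateAt H v s * G s := by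
  have hmap : (walkLaw H v).map (Preorder.frestrictLe (π := fun _ => State V) 0) =
      (stateAt H v).toMeasure.map (MeasurableEquiv.piUnique _).symm := by
    rw [walkLaw, Kernel.trajMeasure, Measure.map_comp _ _ (by fun_prop),
      Kernel.traj_map_frestrictLe, Kernel.partialTraj_self, Measure.id_comp]
  rw [← PMF.lintegral_toMeasure]
  calc ∫⁻ ω, G (ω 0) ∂(walkLaw H v)
      = ∫⁻ h, G (h ⟨0, by simp⟩)
          ∂((walkLaw H v).map (Preorder.frestrictLe (π := fun _ => State V) 0)) := by
        rw [lintegral_map (measurable_of_finite _) (by fun_prop)]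
        rfl
    _ = _ := by
        rw [hmap, lintegral_map (measurable_of_finite _) (by fun_prop)]
        rfl

/-- Markov property at time `k`, for an integrand that may also depend on the history. -/
lemma lintegral_walkLaw_succ {k : ℕ} {F : (ℕ → State V) → State V → ℝ≥0∞}
    (hF : ∀ ω ω', (∀ i ≤ k, ω i = ω' i) → F ω = F ω') :
    ∫⁻ ω, F ω (ω (k + 1)) ∂(walkLaw H v) =
      ∫⁻ ω, ∑' s, step H (ω k) s * F ω s ∂(walkLaw H v) := by
  have key := Kernel.map_frestrictLe_trajMeasure_compProd_eq_map_trajMeasure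
    (X := fun _ => State V) (μ₀ := (stateAt H v).toMeasure)
    (κ := fun n => (stepKernel H).comap
      (fun h : (i : Finset.Iic n) → State V => h ⟨n, Finset.mem_Iic.mpr le_rfl⟩)
      (measurable_pi_apply _)) (a := k)
  rw [← walkLaw] at key
  have hF' : ∀ ω, F ω = F (extend k (Preorder.frestrictLe (π := fun _ => State V) k ω)) :=
    fun ω => hF _ _ fun i hi => (extend_frestrictLe k ω hi).symm
  calc ∫⁻ ω, F ω (ω (k + 1)) ∂(walkLaw H v)
      = ∫⁻ p, F (extend k p.1) p.2 ∂((walkLaw H v).map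
          (fun x => (Preorder.frestrictLe (π := fun _ => State V) k x, x (k + 1)))) := by
        rw [lintegral_map (measurable_of_finite _) (by fun_prop)]
        exact lintegral_congr fun ω => by rw [hF' ω]
    _ = ∫⁻ ω, ∑' s, step H (ω k) s *
          F (extend k (Preorder.frestrictLe (π := fun _ => State V) k ω)) s ∂(walkLaw H v) := by
        rw [← key, Measure.lintegral_compProd (measurable_of_finite _),
          lintegral_map (measurable_of_finite _) (by fun_prop)]
        refine lintegral_congr fun ω => ?_
        rw [← PMF.lintegral_toMeasure]
        rfl
    _ = _ := lintegral_congr fun ω => by rw [← hF' ω]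

lemma ae_zero_of_support {p : State V → Prop} (h0 : ∀ s ∈ (stateAt H v).support, p s) :
    ∀ᵐ ω ∂(walkLaw H v), p (ω 0) := by
  have h : ∫⁻ ω, (if p (ω 0) then 0 else 1) ∂(walkLaw H v) = 0 := by
    rw [lintegral_walkLaw_zero H v fun s => if p s then 0 else 1, ENNReal.tsum_eq_zero]
    intro s
    by_cases hsup : s ∈ (stateAt H v).support
    · simp [h0 s hsup]
    · simp [(PMF.apply_eq_zero_iff _ _).2 hsup]
  rw [lintegral_eq_zero_iff
    (measurable_of_eqOn_Iic (k := 0) fun ω ω' h => by rw [h 0 le_rfl])] at h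
  filter_upwards [h] with ω hω
  simpa using hω

lemma ae_succ_of_support {k : ℕ} {p : (ℕ → State V) → State V → Prop}
    (hp : ∀ ω ω', (∀ i ≤ k, ω i = ω' i) → p ω = p ω')
    (hs : ∀ᵐ ω ∂(walkLaw H v), ∀ s ∈ (step H (ω k)).support, p ω s) :
    ∀ᵐ ω ∂(walkLaw H v), p ω (ω (k + 1)) := by
  have h : ∫⁻ ω, (if p ω (ω (k + 1)) then 0 else 1) ∂(walkLaw H v) = 0 := by
    rw [lintegral_walkLaw_succ H v (F := fun ω s => if p ω s then 0 else 1)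
      fun ω ω' h => by rw [hp ω ω' h], lintegral_congr_ae (g := fun _ => 0), lintegral_zero]
    filter_upwards [hs] with ω hω
    rw [ENNReal.tsum_eq_zero]
    intro s
    by_cases hsup : s ∈ (step H (ω k)).support
    · simp [hω s hsup]
    · simp [(PMF.apply_eq_zero_iff _ _).2 hsup]
  rw [lintegral_eq_zero_iff (measurable_of_eqOn_Iic (k := k + 1) fun ω ω' h => by
    rw [hp ω ω' fun i hi => h i (hi.trans k.le_succ), h (k + 1) le_rfl])] at h
  filter_upwards [h] with ω hω
  simpa using hω

/-- A property that the states drawn by `stateAt` satisfy, and that is preserved by the steps of the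
walk, holds along the whole walk. -/
lemma ae_walkLaw_of_step {p : State V → Prop} (h0 : ∀ s ∈ (stateAt H v).support, p s)
    (hs : ∀ s, p s → ∀ s' ∈ (step H s).support, p s') :
    ∀ᵐ ω ∂(walkLaw H v), ∀ k, p (ω k) := by
  rw [ae_all_iff]
  intro k
  induction k with
  | zero => exact ae_zero_of_support H v h0
  | succ k ih =>
    refine ae_succ_of_support H v (p := fun _ => p) (fun _ _ _ => rfl) ?_
    filter_upwards [ih] with ω hω using hs _ hω

lemma mem_support_stateAt {s : State V} (h : s ∈ (stateAt H v).support) :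
    s.vertex = v ∧ s.vertex ∈ s.edge ∧ (s.edge ∈ H.edgeSet ∨ ¬ ∃ e ∈ H.edgeSet, v ∈ e) := by
  rw [stateAt, PMF.support_map] at h
  obtain ⟨e, he, rfl⟩ := h
  by_cases hv : ({e | e ∈ H.edgeSet ∧ v ∈ e} : Set (Set V)).Nonempty
  · rw [support_uniform (Set.toFinite _) hv] at he
    exact ⟨rfl, he.2, Or.inl he.1⟩
  · rw [uniform, dif_neg fun h => hv h.2, PMF.support_pure] at he
    obtain rfl : e = {v} := he
    exact ⟨rfl, rfl, Or.inr hv⟩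

lemma mem_support_step {s s' : State V} (hs : s.vertex ∈ s.edge) (h : s' ∈ (step H s).support) :
    s'.vertex ∈ s.edge ∧ s' ∈ (stateAt H s'.vertex).support := by
  rw [step, PMF.mem_support_bind_iff] at h
  obtain ⟨x, hx, h⟩ := h
  rw [support_uniform (Set.toFinite _) ⟨_, hs⟩] at hx
  have hv := (mem_support_stateAt H x h).1
  rw [hv]
  exact ⟨hx, h⟩

lemma ae_vertex_zero : ∀ᵐ ω ∂(walkLaw H v), (ω 0).vertex = v :=
  ae_zero_of_support H v fun _ h => (mem_support_stateAt H v h).1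

lemma ae_vertex_mem_edge : ∀ᵐ ω ∂(walkLaw H v), ∀ k, (ω k).vertex ∈ (ω k).edge :=
  ae_walkLaw_of_step H v (fun _ h => (mem_support_stateAt H v h).2.1) fun _ hs _ h =>
    (mem_support_stateAt H _ (mem_support_step H hs h).2).2.1

lemma ae_vertex_succ_mem_edge :
    ∀ᵐ ω ∂(walkLaw H v), ∀ k, (ω (k + 1)).vertex ∈ (ω k).edge := by
  rw [ae_all_iff]
  intro k
  refine ae_succ_of_support H v (p := fun ω s => s.vertex ∈ (ω k).edge)
    (fun ω ω' h => by rw [h k le_rfl]) ?_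
  filter_upwards [ae_vertex_mem_edge H v] with ω hω s h
  exact (mem_support_step H (hω k) h).1

/-- The default `{v}` of `stateAt` never occurs: each new vertex lies in the hyper-edge just used.
-/
lemma ae_edge_mem (hv : ∃ e ∈ H.edgeSet, v ∈ e) :
    ∀ᵐ ω ∂(walkLaw H v), ∀ k, (ω k).edge ∈ H.edgeSet ∧ (ω k).vertex ∈ (ω k).edge := by
  refine ae_walkLaw_of_step H v
    (p := fun s => s.edge ∈ H.edgeSet ∧ s.vertex ∈ s.edge) (fun s h => ?_) fun s hs s' h => ?_
  · obtain ⟨-, h1, h2⟩ := mem_support_stateAt H v h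
    exact ⟨h2.resolve_right (not_not.2 hv), h1⟩
  · obtain ⟨h1, h2⟩ := mem_support_step H hs.2 h
    obtain ⟨-, h3, h4⟩ := mem_support_stateAt H _ h2
    exact ⟨h4.resolve_right (not_not.2 ⟨_, hs.1, h1⟩), h3⟩

/-! ### Comparison of the radio cover time with the cover time -/

omit [Finite V] in
lemma radioHitTime_le_hitTime {ω : ℕ → State V} {u : V}
    (h : ∀ k, (ω (k + 1)).vertex ∈ (ω k).edge) : radioHitTime u ω ≤ hitTime u ω := by
  refine le_iInf₂ fun t ht => iInf₂_le t ?_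
  cases t with
  | zero => exact Or.inl ht
  | succ t => exact Or.inr ⟨t, Nat.lt_succ_self t, ht ▸ h t⟩

lemma radioCoverTime_le_coverTime : radioCoverTime H ≤ coverTime H := by
  refine iSup₂_mono fun v _ => lintegral_mono_ae ?_
  filter_upwards [ae_vertex_succ_mem_edge H v] with ω hω
  exact ENat.toENNReal_le.2 (iSup₂_mono fun u _ => radioHitTime_le_hitTime hω)

end HypergraphWalk

/-! ### The tour and the bound on the cover time -/

namespace HypergraphWalk

open FiniteNetwork Classical

variable {V : Type*}

/-- The targets of `l` that remain at time `k` when they have to be visited in order. -/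
noncomputable def remaining (l : List (V ⊕ Set V)) (ω : ℕ → State V) : ℕ → List (V ⊕ Set V)
  | 0 => advance l (.inr (ω 0).edge)
  | k + 1 => advanceState (remaining l ω k) (ω (k + 1))

lemma remaining_congr (l : List (V ⊕ Set V)) {k : ℕ} {ω ω' : ℕ → State V}
    (h : ∀ i ≤ k, ω i = ω' i) : remaining l ω k = remaining l ω' k := by
  induction k with
  | zero => rw [remaining, remaining, h 0 le_rfl]
  | succ k ih =>
    rw [remaining, remaining, ih fun i hi => h i (hi.trans k.le_succ), h (k + 1) le_rfl]

lemma isChain_remaining {r : V ⊕ Set V → V ⊕ Set V → Prop} {l : List (V ⊕ Set V)}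
    (hl : l.IsChain r) (ω : ℕ → State V) (k : ℕ) : (remaining l ω k).IsChain r := by
  induction k with
  | zero => exact isChain_advance hl _
  | succ k ih => exact isChain_advanceState ih _

lemma mem_remaining_or_visited {l : List (V ⊕ Set V)} {u : V} (h : .inl u ∈ l) (ω : ℕ → State V)
    (k : ℕ) : .inl u ∈ remaining l ω k ∨ ∃ j ≤ k, (ω j).vertex = u := by
  induction k with
  -- At time `0` only the hyper-edge is checked off; the starting vertex heads the tour and is no
  -- target.
  | zero => exact Or.inl ((mem_advance_or_eq h _).resolve_right (by simp))
  | succ k ih =>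
    rcases ih with ih | ⟨j, hj, hju⟩
    · rcases mem_advance_or_eq ih (.inl (ω (k + 1)).vertex) with h1 | h1
      · simpa [remaining, advanceState] using
          Or.inl (mem_advance_or_eq h1 (.inr (ω (k + 1)).edge))
      · exact Or.inr ⟨k + 1, le_rfl, Sum.inl_injective h1⟩
    · exact Or.inr ⟨j, hj.trans k.le_succ, hju⟩

/-- The sum counts the times at which targets remain; once none remain, all vertices have been
visited. -/
lemma iSup_hitTime_le_tsum (H : Hypergraph V) {l : List (V ⊕ Set V)} {ω : ℕ → State V}
    (hl : ∀ u ∈ H.vertexSet, .inl u ∈ .inl (ω 0).vertex :: l) :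
    ((⨆ u ∈ H.vertexSet, hitTime u ω : ℕ∞) : ℝ≥0∞) ≤
      ∑' k, if remaining l ω k = [] then 0 else 1 := by
  by_cases hfin : ∃ k, remaining l ω k = []
  · calc ((⨆ u ∈ H.vertexSet, hitTime u ω : ℕ∞) : ℝ≥0∞)
        ≤ ((Nat.find hfin : ℕ∞) : ℝ≥0∞) := by
          refine ENat.toENNReal_le.2 (iSup₂_le fun u hu => ?_)
          have : ∃ j ≤ Nat.find hfin, (ω j).vertex = u := by
            rcases List.mem_cons.1 (hl u hu) with h | h
            · exact ⟨0, Nat.zero_le _, (Sum.inl_injective h).symm⟩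
            · refine (mem_remaining_or_visited h ω (Nat.find hfin)).resolve_left ?_
              simp [Nat.find_spec hfin]
          obtain ⟨j, hj, hju⟩ := this
          exact (iInf₂_le j hju).trans (Nat.cast_le.2 hj)
      _ = ∑ k ∈ Finset.range (Nat.find hfin), if remaining l ω k = [] then (0 : ℝ≥0∞) else 1 := by
          rw [Finset.sum_congr rfl fun k hk => if_neg (Nat.find_min hfin (Finset.mem_range.1 hk))]
          simp
      _ ≤ _ := ENNReal.sum_le_tsum _
  · push Not at hfin
    simp [hfin]

variable [Fintype V] (H : Hypergraph V) (v : V)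

/-- The drift inequality telescopes: the expected number of times with targets left is at most the
initial mean potential `a 0`. -/
lemma tsum_lintegral_remaining_le (hv : ∃ e ∈ H.edgeSet, v ∈ e) {l : List (V ⊕ Set V)}
    (hl : (.inl v :: l).IsChain fun x y => incidence H x y = 1) :
    ∫⁻ ω, ∑' k, (if remaining l ω k = [] then 0 else 1) ∂(walkLaw H v) ≤
      totalWeight (incidence H) * l.length := by
  have hm : ∀ k, Measurable fun ω : ℕ → State V =>
      if remaining l ω k = [] then (0 : ℝ≥0∞) else 1 := fun k =>
    measurable_of_eqOn_Iic (k := k) fun ω ω' h => by rw [remaining_congr l h]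
  set a : ℕ → ℝ≥0∞ := fun k =>
    ∫⁻ ω, potential (incidence H) (remaining l ω k) (.inr (ω k).edge) ∂(walkLaw H v) with ha
  have hstep : ∀ k, ∫⁻ ω, (if remaining l ω k = [] then 0 else 1) ∂(walkLaw H v) + a (k + 1) ≤
      a k := by
    intro k
    have h := lintegral_walkLaw_succ H v (k := k)
      (F := fun ω s => potential (incidence H) (advanceState (remaining l ω k) s) (.inr s.edge))
      fun ω ω' h => by rw [remaining_congr l h]
    simp only [ha, remaining]
    rw [h, ← lintegral_add_left (hm k)]
    refine lintegral_mono_ae ?_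
    filter_upwards [ae_edge_mem H v hv] with ω hω
    exact tsum_step_mul_potential_le H (hω k).1 (hω k).2 (isChain_remaining hl.tail ω k)
  have hsum : ∀ N, ∑ k ∈ Finset.range N,
      ∫⁻ ω, (if remaining l ω k = [] then 0 else 1) ∂(walkLaw H v) + a N ≤ a 0 := by
    intro N
    induction N with
    | zero => simp
    | succ N ih =>
      rw [Finset.sum_range_succ, add_assoc]
      exact (add_le_add_right (hstep N) _).trans ih
  have h0 : a 0 ≤ totalWeight (incidence H) * l.length := by
    simp only [ha, remaining]
    rw [lintegral_walkLaw_zero H v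
      (fun s => potential (incidence H) (advance l (.inr s.edge)) (.inr s.edge))]
    exact (tsum_stateAt_mul_potential_le H hv hl.tail).trans
      (potential_cons_le (incidence_ne_top H) (incidence_comm H) hl)
  rw [lintegral_tsum fun k => (hm k).aemeasurable, ENNReal.tsum_eq_iSup_nat]
  exact iSup_le fun N => le_self_add.trans ((hsum N).trans h0)

omit [Fintype V] in
lemma exists_adj_boundary {H : Hypergraph V} (hH : IsConnected H) {A : Set V} {v u : V}
    (hv : v ∈ A) (hvH : v ∈ H.vertexSet) (huH : u ∈ H.vertexSet) (hu : u ∉ A) :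
    ∃ a ∈ A, ∃ b ∉ A, H.Adj a b := by
  by_contra! h
  have key : ∀ w, Relation.ReflTransGen H.Adj v w → w ∈ A := by
    intro w hw
    induction hw with
    | refl => exact hv
    | tail _ hbc ih =>
      by_contra hc
      exact h _ ih _ hc hbc
  exact hu (key u (hH v hvH u huH))

/-- A connected hyper-graph has a tour, along its incidences, of length linear in the number of
visited vertices. -/
lemma exists_tour {H : Hypergraph V} (hH : IsConnected H) {v : V} (hv : v ∈ H.vertexSet) (j : ℕ)
    (hj : j + 1 ≤ H.vertexSet.ncard) :
    ∃ l : List (V ⊕ Set V), (.inl v :: l).IsChain (fun x y => incidence H x y = 1) ∧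
      l.length = 4 * j ∧ {u | .inl u ∈ .inl v :: l} ⊆ H.vertexSet ∧
      {u | .inl u ∈ .inl v :: l}.ncard = j + 1 := by
  induction j with
  | zero => exact ⟨[], by simp, rfl, by simpa using hv, by simp⟩
  | succ j ih =>
    obtain ⟨l, hl, hlen, hsub, hcard⟩ := ih (by omega)
    obtain ⟨u, huH, hu⟩ := Set.exists_mem_notMem_of_ncard_lt_ncard
      (show {u | .inl u ∈ Sum.inl v :: l}.ncard < H.vertexSet.ncard by omega)
    obtain ⟨a, ha, b, hb, e, he, hae, hbe⟩ :=
      exists_adj_boundary hH (A := {u | .inl u ∈ Sum.inl v :: l}) (v := v) (by simp) hv huH hu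
    obtain ⟨l₁, l₂, hs⟩ := List.append_of_mem ha
    -- The detour `a, e, b, e, a` replaces one occurrence of `a`: four more nodes for one new
    -- vertex.
    have hchain : (l₁ ++ .inl a :: .inr e :: .inl b :: .inr e :: .inl a :: l₂).IsChain
        (fun x y => incidence H x y = 1) := by
      rw [hs, List.isChain_split] at hl
      rw [List.isChain_split]
      refine ⟨hl.1, ?_⟩
      simp only [List.isChain_cons_cons, hl.2, and_true]
      simp [incidence, he, hae, hbe]
    obtain ⟨l', hl'⟩ : ∃ l', l₁ ++ .inl a :: .inr e :: .inl b :: .inr e :: .inl a :: l₂ =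
        .inl v :: l' := by
      cases l₁ with
      | nil => exact ⟨_, by rw [List.nil_append] at hs ⊢; rw [(List.cons.inj hs).1]⟩
      | cons x l₁ => exact ⟨_, by rw [List.cons_append] at hs ⊢; rw [(List.cons.inj hs).1]⟩
    have hset : {u | .inl u ∈ Sum.inl v :: l'} = insert b {u | .inl u ∈ Sum.inl v :: l} := by
      rw [hs, ← hl']
      ext x
      simp
      tauto
    refine ⟨l', hl' ▸ hchain, ?_, ?_, ?_⟩
    · have h1 := congrArg List.length hs
      have h2 := congrArg List.length hl'
      simp at h1 h2
      omega
    · rw [hset]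
      exact Set.insert_subset (H.mem_vertexSet_of_mem_edgeSet he hbe) hsub
    · rw [hset, Set.ncard_insert_of_notMem hb (Set.toFinite _), hcard]

lemma coverTime_le (hH : IsConnected H) :
    coverTime H ≤ 8 * H.edgeSet.ncard * H.vertexSet.ncard * rank H := by
  refine iSup₂_le fun v hv => ?_
  have hpos : 0 < H.vertexSet.ncard := (Set.ncard_pos (Set.toFinite _)).2 ⟨v, hv⟩
  -- A single vertex may lie in no hyper-edge, but is covered at time `0`; with two or more,
  -- connectedness puts `v` in a hyper-edge.
  by_cases hone : H.vertexSet.ncard = 1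
  · obtain ⟨w, hw⟩ := Set.ncard_eq_one.1 hone
    refine le_trans (le_of_eq ?_) (zero_le (a := _))
    rw [← lintegral_zero (μ := walkLaw H v)]
    refine lintegral_congr_ae ?_
    filter_upwards [ae_vertex_zero H v] with ω hω
    rw [hw] at hv
    obtain rfl : v = w := hv
    have : hitTime v ω = 0 := le_antisymm (iInf₂_le 0 hω) (zero_le (a := _))
    simp [hw, this]
  · obtain ⟨l, hl, hlen, hsub, hcard⟩ := exists_tour hH hv (H.vertexSet.ncard - 1) (by omega)
    have hall := Set.eq_of_subset_of_ncard_le hsub (by omega) (Set.toFinite _)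
    obtain ⟨u, huH, hu⟩ := Set.exists_ne_of_one_lt_ncard (by omega : 1 < H.vertexSet.ncard) v
    have hve : ∃ e ∈ H.edgeSet, v ∈ e := by
      obtain ⟨a, ha, -, -, e, he, hae, -⟩ :=
        exists_adj_boundary hH (A := {v}) (Set.mem_singleton v) hv huH hu
      exact ⟨e, he, Set.mem_singleton_iff.1 ha ▸ hae⟩
    calc ∫⁻ ω, ((⨆ u ∈ H.vertexSet, hitTime u ω : ℕ∞) : ℝ≥0∞) ∂(walkLaw H v)
        ≤ ∫⁻ ω, ∑' k, (if remaining l ω k = [] then 0 else 1) ∂(walkLaw H v) := by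
          refine lintegral_mono_ae ?_
          filter_upwards [ae_vertex_zero H v] with ω hω
          refine iSup_hitTime_le_tsum H fun u hu => ?_
          rw [hω]
          exact hall.superset hu
      _ ≤ totalWeight (incidence H) * l.length := tsum_lintegral_remaining_le H v hve hl
      _ ≤ 2 * (H.edgeSet.ncard * rank H) * (4 * H.vertexSet.ncard) := by
          gcongr
          · exact totalWeight_incidence_le H
          · rw [hlen]
            exact_mod_cast Nat.mul_le_mul_left 4 (Nat.sub_le _ 1)
      _ = 8 * H.edgeSet.ncard * H.vertexSet.ncard * rank H := by ring

end HypergraphWalk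

theorem mainTheorem1 :
    ∃ K : ℝ≥0, ∀ (V : Type*) [Finite V] (H : Hypergraph V), HypergraphWalk.IsConnected H →
      HypergraphWalk.radioCoverTime H ≤ HypergraphWalk.coverTime H ∧
      HypergraphWalk.coverTime H ≤
        (K : ℝ≥0∞) * (H.edgeSet.ncard : ℝ≥0∞) * (H.vertexSet.ncard : ℝ≥0∞) *
          (HypergraphWalk.rank H : ℝ≥0∞) := by
  refine ⟨8, fun V _ H hH => ⟨HypergraphWalk.radioCoverTime_le_coverTime H, ?_⟩⟩
  have := Fintype.ofFinite V
  exact_mod_cast HypergraphWalk.coverTime_le H hH
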